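/- Let $(X_n)_{n\ge 1}$ be a random completely multiplicative function with values on the unit circle of $\mathbb{C}$ (that is, $X_1=1$ and $X_{mn}=X_mX_n$ for all $m,n\ge 1$) such that the variables $(X_p)_{p \text{ prime}}$ are independent and uniformly distributed on the unit circle. For integers $q,N\ge 1$, consider the equation $$\prod_{r=1}^q n_r(n_r+1)=\prod_{r=1}^q n_{q+r}(n_{q+r}+1),\qquad (n_1,\dots,n_{2q})\in\{1,\dots,N\}^{2q},$$ and call a solution trivial if $(n_{q+1},\dots,n_{2q})$ is a permutation of $(n_1,\dots,n_q)$, and nontrivial otherwise. Assume that for every integer $q\ge 1$ the number of nontrivial solutions is $o(N^q)$ as $N\to\infty$. Then, as $N\to\infty$, $$\frac{1}{\sqrt N}\sum_{n=1}^N X_nX_{n+1}$$ converges in distribution to the standard complex Gaussian distribution, that is, to the law of $(\mathcal N_1+i\mathcal N_2)/\sqrt2$, where $\mathcal N_1,\mathcal N_2$ are independent standard real Gaussian random variables. -/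

import Mathlib

open MeasureTheory ProbabilityTheory Filter Asymptotics

/-- The uniform probability distribution on the unit circle of `ℂ`: the law of `exp (i θ)` for `θ`
uniform on `(0, 2π]`. -/
noncomputable def uniformUnitCircle : Measure ℂ :=
  (ProbabilityTheory.cond (volume : Measure ℝ) (Set.Ioc 0 (2 * Real.pi))).map
    fun θ : ℝ => Complex.exp (θ * Complex.I)

/-- `(X n)`, `n ≥ 1`, is a random completely multiplicative function with values on the unit circle,
whose values at the primes are i.i.d. uniform on the unit circle. The value `X 0` plays no role. -/
structure IsUniformRandomMultiplicative {Ω : Type*} [MeasurableSpace Ω] (P : Measure Ω)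
    (X : ℕ → Ω → ℂ) : Prop where
  map_one : ∀ ω, X 1 ω = 1
  map_mul : ∀ m n : ℕ, 1 ≤ m → 1 ≤ n → ∀ ω, X (m * n) ω = X m ω * X n ω
  norm_eq_one : ∀ n : ℕ, 1 ≤ n → ∀ ω, ‖X n ω‖ = 1
  iIndepFun_primes : iIndepFun (fun p : Nat.Primes => X p) P
  hasLaw_prime : ∀ p : Nat.Primes, HasLaw (X p) uniformUnitCircle P

/-- The tuple `(a 0, …, a (q-1), b 0, …, b (q-1))` solves the equation
`∏ a r (a r + 1) = ∏ b r (b r + 1)`. -/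
def IsSolution {q : ℕ} (a b : Fin q → ℕ) : Prop :=
  ∏ r, a r * (a r + 1) = ∏ r, b r * (b r + 1)

/-- A trivial solution: the second half of the tuple is a rearrangement of the first half. -/
def IsTrivialSolution {q : ℕ} (a b : Fin q → ℕ) : Prop :=
  ∃ σ : Equiv.Perm (Fin q), ∀ r, b r = a (σ r)

open Classical in
/-- The number of nontrivial solutions in `{1, …, N} ^ (2 q)`. -/
noncomputable def numNontrivialSolutions (q N : ℕ) : ℕ :=
  (((Fintype.piFinset fun _ : Fin q => Finset.Icc 1 N) ×ˢ
      (Fintype.piFinset fun _ : Fin q => Finset.Icc 1 N)).filter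
    fun s => IsSolution s.1 s.2 ∧ ¬ IsTrivialSolution s.1 s.2).card

/-!
The proof is by the method of moments. Write `S N = ∑ n ≤ N, X n X (n+1)`. The values `X A` are
orthonormal (`IsUniformRandomMultiplicative.integral_mul_conj`), so the mixed moment
`𝔼[S N ^ a * conj (S N) ^ b]` is the number of solutions of `∏ n r (n r + 1) = ∏ m r (m r + 1)` with
`a` variables on the left and `b` on the right
(`IsUniformRandomMultiplicative.integral_sum_pow_mul_conj_sum_pow`).

* If `a = b = q`, the trivial solutions number `q! N ^ q (1 + o(1))` and the others are negligible by
  assumption, so the normalised moment tends to `q!` (`tendsto_card_solutions_self_div`).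
* If `a ≠ b`, the assumption does not speak of such solutions directly. Two solutions `(n, m)` and
  `(n', m')`, each without a value common to its two sides, are glued crosswise into the solution
  `((n, m'), (n', m))` of the balanced equation with `q = a + b`, which is nontrivial apart from
  boundedly many `(n', m')` for each `(n, m)` (`card_disjointSolutions_sq_le`). The square of the
  number of such solutions is therefore `o(N ^ (a + b))`. Common values are removed one at a time at
  the cost of a factor `O(N)` (`card_solutions_succ_le`), so all solutions number
  `o(N ^ ((a + b) / 2))` (`isLittleO_card_solutions_sq`).

The limits of the normalised moments, `a!` if `a = b` and `0` otherwise, are those of the standard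
complex Gaussian law. A Taylor expansion turns this into pointwise convergence of the characteristic
functions (`tendsto_integral_exp_inner_of_tendsto_moments`), and Lévy's theorem concludes.
-/

/-! ### Correlations of the random multiplicative function -/

open scoped ComplexConjugate

instance : IsProbabilityMeasure uniformUnitCircle := by
  have : IsProbabilityMeasure
      (ProbabilityTheory.cond (volume : Measure ℝ) (Set.Ioc 0 (2 * Real.pi))) := by
    refine cond_isProbabilityMeasure_of_finite ?_ ?_ <;>
      simp [Real.pi_pos, ENNReal.mul_eq_top]
  exact Measure.isProbabilityMeasure_map (by fun_prop)

lemma integral_pow_mul_conj_pow_uniformUnitCircle {a b : ℕ} (hab : a ≠ b) :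
    ∫ z, z ^ a * conj z ^ b ∂uniformUnitCircle = 0 := by
  have hc : ((a : ℂ) - b) * Complex.I ≠ 0 :=
    mul_ne_zero (sub_ne_zero.2 (by exact_mod_cast hab)) Complex.I_ne_zero
  have h (θ : ℝ) : Complex.exp (θ * Complex.I) ^ a * conj (Complex.exp (θ * Complex.I)) ^ b
      = Complex.exp (((a : ℂ) - b) * Complex.I * θ) := by
    rw [← Complex.exp_conj, ← Complex.exp_nat_mul, ← Complex.exp_nat_mul, ← Complex.exp_add]
    congr 1
    simp
    ring
  rw [uniformUnitCircle, integral_map (by fun_prop)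
    (Continuous.aestronglyMeasurable (by fun_prop))]
  simp_rw [h]
  rw [ProbabilityTheory.cond, integral_smul_measure,
    ← intervalIntegral.integral_of_le (by positivity), integral_exp_mul_complex hc]
  have : ((a : ℂ) - b) * Complex.I * ((2 * Real.pi : ℝ) : ℂ)
      = ((a - b : ℤ) : ℂ) * (2 * Real.pi * Complex.I) := by
    push_cast
    ring
  rw [this, Complex.exp_int_mul_two_pi_mul_I]
  simp

namespace IsUniformRandomMultiplicative

variable {Ω : Type*} [MeasurableSpace Ω] {P : Measure Ω} {X : ℕ → Ω → ℂ}

lemma ne_zero (hX : IsUniformRandomMultiplicative P X) {n : ℕ} (hn : 1 ≤ n) (ω : Ω) :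
    X n ω ≠ 0 := by
  rw [← norm_ne_zero_iff, hX.norm_eq_one n hn ω]
  exact one_ne_zero

lemma apply_prod (hX : IsUniformRandomMultiplicative P X) {ι : Type*} (s : Finset ι) (g : ι → ℕ)
    (hg : ∀ i ∈ s, 1 ≤ g i) (ω : Ω) : X (∏ i ∈ s, g i) ω = ∏ i ∈ s, X (g i) ω := by
  classical
  induction s using Finset.induction_on with
  | empty => simpa using hX.map_one ω
  | insert i s hi ih =>
    rw [Finset.prod_insert hi, Finset.prod_insert hi,
      hX.map_mul _ _ (hg i (by simp)) (Nat.one_le_iff_ne_zero.2 (Finset.prod_ne_zero_iff.2 fun j hj =>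
        Nat.one_le_iff_ne_zero.1 (hg j (Finset.mem_insert_of_mem hj)))),
      ih fun j hj => hg j (Finset.mem_insert_of_mem hj)]

lemma apply_pow (hX : IsUniformRandomMultiplicative P X) {n : ℕ} (hn : 1 ≤ n) (k : ℕ) (ω : Ω) :
    X (n ^ k) ω = X n ω ^ k := by
  simpa using hX.apply_prod (Finset.range k) (fun _ => n) (fun _ _ => hn) ω

/-- Expansion of `X n` over any finite set of primes containing the prime divisors of `n`. -/
lemma apply_eq_prod_primes (hX : IsUniformRandomMultiplicative P X) {n : ℕ} (hn : n ≠ 0)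
    (s : Finset Nat.Primes) (hs : ∀ p : Nat.Primes, (p : ℕ) ∣ n → p ∈ s) (ω : Ω) :
    X n ω = ∏ p : s, X (p : Nat.Primes) ω ^ n.factorization p := by
  let e : Nat.Primes ↪ ℕ := ⟨fun p => p, Subtype.coe_injective⟩
  have h : ∏ p ∈ s, (p : ℕ) ^ n.factorization p = n := by
    have h1 : ∏ p ∈ s.map e, p ^ n.factorization p = n := by
      conv_rhs => rw [← Nat.prod_factorization_pow_eq_self hn]
      refine (Finsupp.prod_of_support_subset _ ?_ _ (by simp)).symm
      intro p hp
      have hp' := Nat.prime_of_mem_primeFactors hp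
      exact Finset.mem_map.2 ⟨⟨p, hp'⟩, hs _ (Nat.dvd_of_mem_primeFactors hp), rfl⟩
    exact (Finset.prod_map s e _).symm.trans h1
  have h2 := Finset.prod_coe_sort s fun p : Nat.Primes => X p ω ^ n.factorization p
  rw [h2]
  conv_lhs => rw [← h]
  rw [hX.apply_prod _ _ fun p _ => Nat.one_le_pow _ _ p.2.pos]
  exact Finset.prod_congr rfl fun p _ => hX.apply_pow p.2.one_le _ ω

lemma exists_finset_primes (n : ℕ) (hn : n ≠ 0) :
    ∃ s : Finset Nat.Primes, ∀ p : Nat.Primes, (p : ℕ) ∣ n → p ∈ s :=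
  ⟨n.primeFactors.subtype Nat.Prime, fun p hp =>
    Finset.mem_subtype.2 (Nat.mem_primeFactors.2 ⟨p.2, hp, hn⟩)⟩

lemma aemeasurable (hX : IsUniformRandomMultiplicative P X) {n : ℕ} (hn : n ≠ 0) :
    AEMeasurable (X n) P := by
  obtain ⟨s, hs⟩ := exists_finset_primes n hn
  have : X n = fun ω => ∏ p : s, X (p : Nat.Primes) ω ^ n.factorization p :=
    funext (hX.apply_eq_prod_primes hn s hs)
  rw [this]
  exact Finset.aemeasurable_fun_prod _ fun p _ => (hX.hasLaw_prime p).aemeasurable.pow_const _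

/-- Orthogonality: by independence the correlation factors over primes, and a prime whose exponents
in `A` and `B` differ contributes a vanishing factor. -/
lemma integral_mul_conj [IsProbabilityMeasure P] (hX : IsUniformRandomMultiplicative P X)
    {A B : ℕ} (hA : A ≠ 0) (hB : B ≠ 0) :
    ∫ ω, X A ω * conj (X B ω) ∂P = if A = B then 1 else 0 := by
  split_ifs with hAB
  · subst hAB
    simp [Complex.mul_conj, Complex.normSq_eq_norm_sq, hX.norm_eq_one A (Nat.pos_of_ne_zero hA)]
  obtain ⟨s, hs⟩ := exists_finset_primes (A * B) (mul_ne_zero hA hB)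
  have hind := hX.iIndepFun_primes.precomp (g := ((↑) : s → Nat.Primes)) Subtype.coe_injective
  have hfac := hind.integral_fun_prod_comp
    (f := fun (p : s) z => z ^ A.factorization (p : Nat.Primes)
      * conj z ^ B.factorization (p : Nat.Primes))
    (fun p => (hX.hasLaw_prime p).aemeasurable)
    (fun p => Continuous.aestronglyMeasurable (by fun_prop))
  have hexp (ω : Ω) : X A ω * conj (X B ω)
      = ∏ p : s, (X (p : Nat.Primes) ω ^ A.factorization p
          * conj (X (p : Nat.Primes) ω) ^ B.factorization p) := by
    rw [hX.apply_eq_prod_primes hA s (fun p hp => hs p (hp.mul_right B)),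
      hX.apply_eq_prod_primes hB s (fun p hp => hs p (hp.mul_left A)), map_prod,
      Finset.prod_mul_distrib]
    simp only [map_pow]
  simp_rw [hexp]
  rw [hfac]
  obtain ⟨p, hp⟩ : ∃ p, A.factorization p ≠ B.factorization p := by
    by_contra! h
    exact hAB (Nat.eq_of_factorization_eq hA hB h)
  have hpp : p.Prime := by
    by_contra h
    simp [Nat.factorization_eq_zero_of_not_prime, h] at hp
  have hps : (⟨p, hpp⟩ : Nat.Primes) ∈ s := by
    refine hs _ ?_
    by_contra h
    have h' : ¬ p ∣ A ∧ ¬ p ∣ B := ⟨fun h1 => h (h1.mul_right B), fun h1 => h (h1.mul_left A)⟩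
    exact hp (by rw [Nat.factorization_eq_zero_of_not_dvd h'.1,
      Nat.factorization_eq_zero_of_not_dvd h'.2])
  refine Finset.prod_eq_zero (Finset.mem_univ ⟨⟨p, hpp⟩, hps⟩) ?_
  have := (hX.hasLaw_prime ⟨p, hpp⟩).integral_comp
    (f := fun z => z ^ A.factorization p * conj z ^ B.factorization p)
    (Continuous.aestronglyMeasurable (by fun_prop))
  exact this.trans (integral_pow_mul_conj_pow_uniformUnitCircle hp)

end IsUniformRandomMultiplicative

/-! ### Counting solutions -/

open scoped Nat Topology

open Classical in
/-- Solutions in `{1, …, N}` of `∏ n r (n r + 1) = ∏ m r (m r + 1)` with `a` factors on the left and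
`b` factors on the right. -/
noncomputable def solutions (a b N : ℕ) : Finset ((Fin a → ℕ) × (Fin b → ℕ)) :=
  ((Fintype.piFinset fun _ => Finset.Icc 1 N) ×ˢ (Fintype.piFinset fun _ => Finset.Icc 1 N)).filter
    fun s => ∏ r, s.1 r * (s.1 r + 1) = ∏ r, s.2 r * (s.2 r + 1)

open Classical in
/-- Solutions for which the two sides have no variable value in common. -/
noncomputable def disjointSolutions (a b N : ℕ) : Finset ((Fin a → ℕ) × (Fin b → ℕ)) :=
  (solutions a b N).filter fun s => ∀ i j, s.1 i ≠ s.2 j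

lemma mem_solutions {a b N : ℕ} {s : (Fin a → ℕ) × (Fin b → ℕ)} :
    s ∈ solutions a b N ↔ ((∀ i, s.1 i ∈ Finset.Icc 1 N) ∧ ∀ j, s.2 j ∈ Finset.Icc 1 N) ∧
      ∏ r, s.1 r * (s.1 r + 1) = ∏ r, s.2 r * (s.2 r + 1) := by
  simp only [solutions, Finset.mem_filter, Finset.mem_product, Fintype.mem_piFinset]

lemma mem_disjointSolutions {a b N : ℕ} {s : (Fin a → ℕ) × (Fin b → ℕ)} :
    s ∈ disjointSolutions a b N ↔ s ∈ solutions a b N ∧ ∀ i j, s.1 i ≠ s.2 j := by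
  simp only [disjointSolutions, Finset.mem_filter]

/-- Gluing two disjoint solutions `(n, m)` and `(n', m')` crosswise into `((n, m'), (n', m))` gives a
solution with `a + b` factors on each side. If it is trivial, then `n'`, which avoids the values of
`m'`, takes its values among those of `n`; likewise `m'` takes its values among those of `m`. So at
most `a ^ a * b ^ b` choices of `(n', m')` are lost for each `(n, m)`. -/
lemma card_disjointSolutions_sq_le (a b N : ℕ) :
    (disjointSolutions a b N).card ^ 2 ≤
      numNontrivialSolutions (a + b) N + (disjointSolutions a b N).card * (a ^ a * b ^ b) := by
  classical
  set D := disjointSolutions a b N with hD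
  let glue : ((Fin a → ℕ) × (Fin b → ℕ)) × ((Fin a → ℕ) × (Fin b → ℕ)) →
      (Fin (a + b) → ℕ) × (Fin (a + b) → ℕ) :=
    fun s => (Fin.append s.1.1 s.2.2, Fin.append s.2.1 s.1.2)
  have hglue : Function.Injective glue := by
    rintro ⟨⟨n, m⟩, ⟨n', m'⟩⟩ ⟨⟨k, l⟩, ⟨k', l'⟩⟩ h
    simp only [glue, Prod.mk.injEq] at h
    obtain ⟨h1, h2⟩ := h
    have e1 : n = k := funext fun i => by simpa using congrFun h1 (Fin.castAdd b i)
    have e2 : m' = l' := funext fun i => by simpa using congrFun h1 (Fin.natAdd a i)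
    have e3 : n' = k' := funext fun i => by simpa using congrFun h2 (Fin.castAdd b i)
    have e4 : m = l := funext fun i => by simpa using congrFun h2 (Fin.natAdd a i)
    subst e1 e2 e3 e4
    rfl
  let T := (D ×ˢ D).filter fun s => IsTrivialSolution (glue s).1 (glue s).2
  let U := (D ×ˢ D).filter fun s => ¬ IsTrivialSolution (glue s).1 (glue s).2
  have hTU : D.card ^ 2 = T.card + U.card := by
    rw [Finset.card_filter_add_card_filter_not, Finset.card_product, sq]
  have hU : U.card ≤ numNontrivialSolutions (a + b) N := by
    refine Finset.card_le_card_of_injOn glue (fun s hs => ?_) hglue.injOn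
    have hs := Finset.mem_filter.1 hs
    obtain ⟨h1, h2⟩ := Finset.mem_product.1 hs.1
    obtain ⟨⟨hn, hm⟩, e⟩ := mem_solutions.1 (mem_disjointSolutions.1 h1).1
    obtain ⟨⟨hn', hm'⟩, e'⟩ := mem_solutions.1 (mem_disjointSolutions.1 h2).1
    simp only [Finset.coe_filter, Set.mem_ofPred_eq, Finset.mem_product, Fintype.mem_piFinset]
    refine ⟨⟨fun r => ?_, fun r => ?_⟩, ?_, hs.2⟩
    · refine Fin.addCases (fun i => ?_) (fun i => ?_) r
      · simpa [glue] using hn i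
      · simpa [glue] using hm' i
    · refine Fin.addCases (fun i => ?_) (fun i => ?_) r
      · simpa [glue] using hn' i
      · simpa [glue] using hm i
    · simp only [IsSolution, glue, Fin.prod_univ_add, Fin.append_left, Fin.append_right]
      rw [e, ← e', mul_comm]
  have hT : T.card ≤ D.card * (a ^ a * b ^ b) := by
    let F : ((Fin a → ℕ) × (Fin b → ℕ)) × ((Fin a → Fin a) × (Fin b → Fin b)) →
        ((Fin a → ℕ) × (Fin b → ℕ)) × ((Fin a → ℕ) × (Fin b → ℕ)) :=
      fun s => (s.1, (s.1.1 ∘ s.2.1, s.1.2 ∘ s.2.2))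
    have hsub : T ⊆ (D ×ˢ Finset.univ).image F := by
      rintro ⟨⟨n, m⟩, ⟨n', m'⟩⟩ hs
      obtain ⟨h, σ, hσ⟩ := Finset.mem_filter.1 hs
      obtain ⟨h1, h2⟩ := Finset.mem_product.1 h
      have hd' : ∀ i j, n' i ≠ m' j := (mem_disjointSolutions.1 h2).2
      simp only [glue] at hσ
      have hn : ∀ i, ∃ k, n' i = n k := by
        intro i
        have h3 := hσ (Fin.castAdd b i)
        rw [Fin.append_left] at h3
        rcases Fin.addCases (motive := fun r => (∃ k, r = Fin.castAdd b k) ∨ ∃ k, r = Fin.natAdd a k)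
          (fun k => .inl ⟨k, rfl⟩) (fun k => .inr ⟨k, rfl⟩) (σ (Fin.castAdd b i)) with ⟨k, hk⟩ | ⟨k, hk⟩
        · exact ⟨k, by rw [h3, hk, Fin.append_left]⟩
        · exact absurd (by rw [h3, hk, Fin.append_right]) (hd' i k)
      have hm : ∀ j, ∃ k, m' j = m k := by
        intro j
        have h3 := hσ (σ.symm (Fin.natAdd a j))
        rw [Equiv.apply_symm_apply, Fin.append_right] at h3
        rcases Fin.addCases (motive := fun r => (∃ k, r = Fin.castAdd b k) ∨ ∃ k, r = Fin.natAdd a k)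
          (fun k => .inl ⟨k, rfl⟩) (fun k => .inr ⟨k, rfl⟩) (σ.symm (Fin.natAdd a j))
          with ⟨k, hk⟩ | ⟨k, hk⟩
        · rw [hk, Fin.append_left] at h3
          exact absurd h3 (hd' k j)
        · exact ⟨k, by rw [← h3, hk, Fin.append_right]⟩
      choose g hg using hn
      choose g' hg' using hm
      refine Finset.mem_image.2 ⟨((n, m), (g, g')), Finset.mem_product.2 ⟨h1, Finset.mem_univ _⟩, ?_⟩
      simp only [F, Prod.mk.injEq, true_and]
      exact ⟨funext fun i => (hg i).symm, funext fun j => (hg' j).symm⟩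
    refine (Finset.card_le_card hsub).trans (Finset.card_image_le.trans_eq ?_)
    rw [Finset.card_product, Finset.card_univ, Fintype.card_prod]
    simp
  omega

/-- A solution with a value in common on both sides is obtained from one with a factor less on each
side by inserting that value. -/
lemma card_solutions_succ_le (a b N : ℕ) :
    (solutions (a + 1) (b + 1) N).card ≤
      (disjointSolutions (a + 1) (b + 1) N).card
        + ((a + 1) * (b + 1)) * (N * (solutions a b N).card) := by
  classical
  let F : (Fin (a + 1) × Fin (b + 1)) × (ℕ × ((Fin a → ℕ) × (Fin b → ℕ))) →
      (Fin (a + 1) → ℕ) × (Fin (b + 1) → ℕ) :=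
    fun s => (Fin.insertNth s.1.1 s.2.1 s.2.2.1, Fin.insertNth s.1.2 s.2.1 s.2.2.2)
  have hsub : solutions (a + 1) (b + 1) N ⊆ disjointSolutions (a + 1) (b + 1) N ∪
      (Finset.univ ×ˢ (Finset.Icc 1 N ×ˢ solutions a b N)).image F := by
    rintro ⟨n, m⟩ hs
    by_cases hd : ∀ i j, n i ≠ m j
    · exact Finset.mem_union_left _ (mem_disjointSolutions.2 ⟨hs, hd⟩)
    push Not at hd
    obtain ⟨i, j, hij⟩ := hd
    obtain ⟨⟨hn, hm⟩, e⟩ := mem_solutions.1 hs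
    refine Finset.mem_union_right _ (Finset.mem_image.2
      ⟨((i, j), (n i, (i.removeNth n, j.removeNth m))), ?_, ?_⟩)
    · refine Finset.mem_product.2 ⟨Finset.mem_univ _, Finset.mem_product.2 ⟨hn i, ?_⟩⟩
      refine mem_solutions.2 ⟨⟨fun k => hn _, fun k => hm _⟩, ?_⟩
      simp only [Fin.prod_univ_succAbove _ i, Fin.prod_univ_succAbove _ j] at e
      rw [hij] at e
      have := (Finset.mem_Icc.1 (hm j)).1
      exact Nat.eq_of_mul_eq_mul_left (by positivity) e
    · simp only [F, Prod.mk.injEq]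
      refine ⟨Fin.insertNth_self_removeNth i n, ?_⟩
      rw [hij]
      exact Fin.insertNth_self_removeNth j m
  refine (Finset.card_le_card hsub).trans ((Finset.card_union_le _ _).trans ?_)
  refine Nat.add_le_add_left (Finset.card_image_le.trans_eq ?_) _
  simp [Finset.card_product]

lemma prod_mul_succ_ne_zero {a N : ℕ} {n : Fin a → ℕ} (hn : ∀ i, n i ∈ Finset.Icc 1 N) :
    ∏ r, n r * (n r + 1) ≠ 0 :=
  Finset.prod_ne_zero_iff.2 fun i _ => by
    have := (Finset.mem_Icc.1 (hn i)).1
    positivity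

lemma isLittleO_card_disjointSolutions_sq
    (hcount : ∀ q : ℕ, 1 ≤ q →
      (fun N : ℕ => (numNontrivialSolutions q N : ℝ)) =o[atTop] fun N : ℕ => (N : ℝ) ^ q)
    {a b : ℕ} (hab : 1 ≤ a + b) :
    (fun N : ℕ => ((disjointSolutions a b N).card : ℝ) ^ 2) =o[atTop]
      fun N : ℕ => (N : ℝ) ^ (a + b) := by
  set C : ℝ := (a : ℝ) ^ a * (b : ℝ) ^ b with hC
  have hconst : (fun _ : ℕ => C ^ 2) =o[atTop] fun N : ℕ => (N : ℝ) ^ (a + b) := by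
    refine isLittleO_const_left.2 (.inr ?_)
    exact tendsto_norm_atTop_atTop.comp
      ((tendsto_pow_atTop (by omega)).comp tendsto_natCast_atTop_atTop)
  refine IsBigO.trans_isLittleO (IsBigO.of_bound 1 (.of_forall fun N => ?_))
    (((hcount (a + b) hab).const_mul_left 2).add hconst)
  have h := card_disjointSolutions_sq_le a b N
  have h' : ((disjointSolutions a b N).card : ℝ) ^ 2 ≤
      numNontrivialSolutions (a + b) N + (disjointSolutions a b N).card * C := by
    rw [hC]
    exact_mod_cast h
  rw [one_mul, Real.norm_of_nonneg (by positivity), Real.norm_of_nonneg (by positivity)]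
  -- `x ^ 2 ≤ y + C x` and `2 C x ≤ x ^ 2 + C ^ 2` give `x ^ 2 ≤ 2 y + C ^ 2`.
  nlinarith [sq_nonneg (((disjointSolutions a b N).card : ℝ) - C)]

/-- With different numbers of factors on the two sides, there are `o(N ^ ((a + b) / 2))`
solutions. -/
lemma isLittleO_card_solutions_sq
    (hcount : ∀ q : ℕ, 1 ≤ q →
      (fun N : ℕ => (numNontrivialSolutions q N : ℝ)) =o[atTop] fun N : ℕ => (N : ℝ) ^ q)
    {a b : ℕ} (hab : a ≠ b) :
    (fun N : ℕ => ((solutions a b N).card : ℝ) ^ 2) =o[atTop] fun N : ℕ => (N : ℝ) ^ (a + b) := by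
  induction a generalizing b with
  | zero =>
    have h (N : ℕ) : solutions 0 b N = disjointSolutions 0 b N := by
      ext s
      simp [mem_disjointSolutions]
    simp_rw [h]
    exact isLittleO_card_disjointSolutions_sq hcount (by omega)
  | succ a ih =>
    cases b with
    | zero =>
      have h (N : ℕ) : solutions (a + 1) 0 N = disjointSolutions (a + 1) 0 N := by
        ext s
        simp [mem_disjointSolutions]
      simp_rw [h]
      exact isLittleO_card_disjointSolutions_sq hcount (by omega)
    | succ b =>
      set K : ℝ := ((a : ℝ) + 1) * (b + 1) with hK
      have h1 := isLittleO_card_disjointSolutions_sq hcount (show 1 ≤ (a + 1) + (b + 1) by omega)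
      have h2 : (fun N : ℕ => (N : ℝ) ^ 2 * ((solutions a b N).card : ℝ) ^ 2) =o[atTop]
          fun N : ℕ => (N : ℝ) ^ ((a + 1) + (b + 1)) := by
        refine ((isBigO_refl (fun N : ℕ => (N : ℝ) ^ 2) atTop).mul_isLittleO
          (ih (b := b) (by omega))).congr_right fun N => ?_
        ring
      refine IsBigO.trans_isLittleO (IsBigO.of_bound 1 (.of_forall fun N => ?_))
        ((h1.const_mul_left 2).add (h2.const_mul_left (2 * K ^ 2)))
      have h := card_solutions_succ_le a b N
      have h' : ((solutions (a + 1) (b + 1) N).card : ℝ) ≤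
          (disjointSolutions (a + 1) (b + 1) N).card + K * (N * (solutions a b N).card) := by
        rw [hK]
        exact_mod_cast h
      rw [one_mul, Real.norm_of_nonneg (by positivity), Real.norm_of_nonneg (by positivity)]
      refine (pow_le_pow_left₀ (by positivity) h' 2).trans ?_
      refine (add_sq_le).trans_eq ?_
      ring

open Classical in
/-- The trivial solutions with `q` factors on each side and values in `{1, …, N}`. -/
noncomputable def trivialSolutions (q N : ℕ) : Finset ((Fin q → ℕ) × (Fin q → ℕ)) :=
  ((Fintype.piFinset fun _ => Finset.Icc 1 N) ×ˢ (Fintype.piFinset fun _ => Finset.Icc 1 N)).filter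
    fun s => IsTrivialSolution s.1 s.2

lemma IsTrivialSolution.isSolution {q : ℕ} {a b : Fin q → ℕ} (h : IsTrivialSolution a b) :
    IsSolution a b := by
  obtain ⟨σ, hσ⟩ := h
  simp only [IsSolution, hσ]
  exact (Equiv.prod_comp σ fun r => a r * (a r + 1)).symm

lemma card_solutions_self (q N : ℕ) :
    (solutions q q N).card = (trivialSolutions q N).card + numNontrivialSolutions q N := by
  classical
  rw [solutions, ← Finset.card_filter_add_card_filter_not (fun s => IsTrivialSolution s.1 s.2),
    Finset.filter_filter, Finset.filter_filter, trivialSolutions, numNontrivialSolutions]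
  congr 2
  · exact Finset.filter_congr fun s _ => ⟨fun h => h.2, fun h => ⟨h.isSolution, h⟩⟩
  · exact Finset.filter_congr fun s _ => Iff.rfl

lemma card_trivialSolutions_le (q N : ℕ) : (trivialSolutions q N).card ≤ q ! * N ^ q := by
  classical
  let F : Equiv.Perm (Fin q) × (Fin q → ℕ) → (Fin q → ℕ) × (Fin q → ℕ) :=
    fun s => (s.2, s.2 ∘ s.1)
  have hsub : trivialSolutions q N ⊆
      (Finset.univ ×ˢ Fintype.piFinset fun _ => Finset.Icc 1 N).image F := by
    rintro ⟨n, m⟩ hs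
    obtain ⟨h, σ, hσ⟩ := Finset.mem_filter.1 hs
    exact Finset.mem_image.2 ⟨(σ, n), Finset.mem_product.2
      ⟨Finset.mem_univ _, (Finset.mem_product.1 h).1⟩, by
        simp only [F, Prod.mk.injEq, true_and]; exact funext fun r => (hσ r).symm⟩
  refine (Finset.card_le_card hsub).trans (Finset.card_image_le.trans_eq ?_)
  simp [Finset.card_product, Fintype.card_perm]

/-- Each of the `N.descFactorial q` injective tuples has `q !` distinct rearrangements. -/
lemma le_card_trivialSolutions (q N : ℕ) : q ! * N.descFactorial q ≤ (trivialSolutions q N).card := by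
  classical
  let F : Equiv.Perm (Fin q) × (Fin q ↪ Finset.Icc 1 N) → (Fin q → ℕ) × (Fin q → ℕ) :=
    fun s => (fun r => s.2 r, fun r => s.2 (s.1 r))
  have hF : Function.Injective F := by
    rintro ⟨σ, f⟩ ⟨τ, g⟩ h
    simp only [F, Prod.mk.injEq] at h
    have h1 : f = g := by
      ext r
      exact congrFun h.1 r
    subst h1
    have h2 : σ = τ := Equiv.ext fun r => f.injective (Subtype.ext (congrFun h.2 r))
    rw [h2]
  have hcard : (Finset.univ.image F).card = q ! * N.descFactorial q := by
    rw [Finset.card_image_of_injective _ hF, Finset.card_univ, Fintype.card_prod,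
      Fintype.card_perm, Fintype.card_embedding_eq]
    simp
  rw [← hcard]
  refine Finset.card_le_card fun s hs => ?_
  obtain ⟨⟨σ, f⟩, -, rfl⟩ := Finset.mem_image.1 hs
  refine Finset.mem_filter.2 ⟨Finset.mem_product.2 ⟨?_, ?_⟩, σ, fun r => rfl⟩
  · exact Fintype.mem_piFinset.2 fun r => (f r).2
  · exact Fintype.mem_piFinset.2 fun r => (f (σ r)).2

lemma tendsto_card_solutions_self_div
    (hcount : ∀ q : ℕ, 1 ≤ q →
      (fun N : ℕ => (numNontrivialSolutions q N : ℝ)) =o[atTop] fun N : ℕ => (N : ℝ) ^ q) (q : ℕ) :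
    Tendsto (fun N : ℕ => ((solutions q q N).card : ℝ) / (N : ℝ) ^ q) atTop (𝓝 (q ! : ℝ)) := by
  have hnt : Tendsto (fun N : ℕ => (numNontrivialSolutions q N : ℝ) / (N : ℝ) ^ q) atTop (𝓝 0) := by
    rcases Nat.eq_zero_or_pos q with rfl | hq
    · have h (N : ℕ) : numNontrivialSolutions 0 N = 0 := by
        rw [numNontrivialSolutions, Finset.card_eq_zero]
        refine Finset.eq_empty_of_forall_notMem fun s hs => ?_
        simp only [Finset.mem_filter] at hs
        exact hs.2.2 ⟨1, fun r => r.elim0⟩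
      simp [h]
    · exact (hcount q hq).tendsto_div_nhds_zero
  have htr : Tendsto (fun N : ℕ => ((trivialSolutions q N).card : ℝ) / (N : ℝ) ^ q) atTop
      (𝓝 (q ! : ℝ)) := by
    have hdesc : Tendsto (fun N : ℕ => (q ! : ℝ) * ((N.descFactorial q : ℝ) / (N : ℝ) ^ q)) atTop
        (𝓝 (q ! : ℝ)) := by
      have h := ((isEquivalent_iff_tendsto_one ?_).1 (isEquivalent_descFactorial q)).const_mul
        (q ! : ℝ)
      · rw [mul_one] at h
        exact h
      · filter_upwards [eventually_gt_atTop 0] with N hN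
        positivity
    refine tendsto_of_tendsto_of_tendsto_of_le_of_le' hdesc tendsto_const_nhds
      (.of_forall fun N => ?_) ?_
    · rw [← mul_div_assoc]
      gcongr
      exact_mod_cast le_card_trivialSolutions q N
    · filter_upwards [eventually_gt_atTop 0] with N hN
      rw [div_le_iff₀ (by positivity)]
      exact_mod_cast card_trivialSolutions_le q N
  have := htr.add hnt
  rw [add_zero] at this
  refine this.congr fun N => ?_
  rw [card_solutions_self, Nat.cast_add, add_div]

/-! ### The method of moments for the complex Gaussian law -/

open scoped ComplexConjugate RealInnerProductSpace Topology Nat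

lemma norm_exp_mul_I_sub_sum_le (k : ℕ) (x : ℝ) :
    ‖Complex.exp (x * Complex.I) - ∑ j ∈ Finset.range k, (x * Complex.I) ^ j / (j ! : ℂ)‖
      ≤ |x| ^ k / k ! := by
  induction k generalizing x with
  | zero => simp [Complex.norm_exp_ofReal_mul_I]
  | succ k ih =>
    -- Compare the derivatives along the segment from `0` to `x`, parametrised by `[0, 1]`.
    set R : ℝ → ℂ := fun s => Complex.exp ((s * x : ℝ) * Complex.I)
      - ∑ j ∈ Finset.range (k + 1), ((s * x : ℝ) * Complex.I) ^ j / j ! with hR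
    set R' : ℝ → ℂ := fun s => (x * Complex.I) * (Complex.exp ((s * x : ℝ) * Complex.I)
      - ∑ j ∈ Finset.range k, ((s * x : ℝ) * Complex.I) ^ j / j !) with hR'
    have hlin (s : ℝ) : HasDerivAt (fun s : ℝ => ((s * x : ℝ) : ℂ) * Complex.I)
        (x * Complex.I) s := by
      have := ((hasDerivAt_id s).mul_const x).ofReal_comp.mul_const Complex.I
      simpa using this
    have hderiv (s : ℝ) : HasDerivAt R (R' s) s := by
      have hs : HasDerivAt (fun s : ℝ => ∑ j ∈ Finset.range (k + 1),
          (((s * x : ℝ) : ℂ) * Complex.I) ^ j / j !)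
          (∑ j ∈ Finset.range (k + 1), ((j : ℂ) * (((s * x : ℝ) : ℂ) * Complex.I) ^ (j - 1)
            * (x * Complex.I)) / j !) s :=
        HasDerivAt.fun_sum fun j _ => ((hlin s).pow j).div_const _
      refine ((hlin s).cexp.sub hs).congr_deriv ?_
      rw [Finset.sum_range_succ']
      simp only [hR', Nat.cast_zero, zero_mul, zero_div, add_zero, Nat.add_sub_cancel, mul_sub,
        Finset.mul_sum]
      congr 1
      · ring
      · refine Finset.sum_congr rfl fun j _ => ?_
        rw [Nat.factorial_succ]
        have h1 : ((j + 1 : ℕ) : ℂ) ≠ 0 := by exact_mod_cast j.succ_ne_zero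
        have h2 : ((j ! : ℕ) : ℂ) ≠ 0 := by exact_mod_cast j.factorial_ne_zero
        rw [Nat.cast_mul]
        field_simp
    have hB (s : ℝ) : HasDerivAt (fun s : ℝ => s ^ (k + 1) * (|x| ^ (k + 1) / (k + 1)!))
        (|x| * ((s * |x|) ^ k / k !)) s := by
      refine ((hasDerivAt_pow (k + 1) s).mul_const _).congr_deriv ?_
      have h1 : ((k + 1 : ℕ) : ℝ) ≠ 0 := by exact_mod_cast k.succ_ne_zero
      have h2 : ((k ! : ℕ) : ℝ) ≠ 0 := by exact_mod_cast k.factorial_ne_zero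
      rw [Nat.factorial_succ, Nat.cast_mul, Nat.add_sub_cancel]
      field_simp
      ring
    have key := image_norm_le_of_norm_deriv_right_le_deriv_boundary (a := 0) (b := 1)
      (fun s _ => (hderiv s).continuousAt.continuousWithinAt)
      (fun s _ => (hderiv s).hasDerivWithinAt) (B := fun s => s ^ (k + 1) * (|x| ^ (k + 1) / (k + 1)!))
      (by simp [hR, Finset.sum_range_succ']) hB
      (fun s hs => by
        have := ih (s * x)
        rw [abs_mul, abs_of_nonneg hs.1] at this
        simp only [hR', norm_mul, Complex.norm_I, mul_one, Complex.norm_real, Real.norm_eq_abs]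
        exact mul_le_mul_of_nonneg_left this (abs_nonneg x))
      (Set.right_mem_Icc.2 zero_le_one)
    simpa [hR] using key

/-- `k`-th moment of the real centred Gaussian variable `⟪Z, t⟫`, where `Z` is standard complex
Gaussian, in the form produced by expanding `⟪z, t⟫ = (conj t * z + t * conj z) / 2`. -/
noncomputable def projectedMoment (t : ℂ) (k : ℕ) : ℂ :=
  ∑ m ∈ Finset.range (k + 1), (conj t / 2) ^ m * (t / 2) ^ (k - m) * k.choose m
    * (if m = k - m then (m ! : ℂ) else 0)

lemma projectedMoment_two_mul (t : ℂ) (j : ℕ) :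
    projectedMoment t (2 * j) = (2 * j)! / j ! * ((‖t‖ ^ 2 / 4 : ℝ) : ℂ) ^ j := by
  rw [projectedMoment, Finset.sum_eq_single_of_mem j (by simp; omega)]
  · have h1 : 2 * j - j = j := by omega
    have h2 : (conj t / 2) * (t / 2) = ((‖t‖ ^ 2 / 4 : ℝ) : ℂ) := by
      rw [← Complex.normSq_eq_norm_sq]
      push_cast
      rw [Complex.normSq_eq_conj_mul_self]
      ring
    rw [h1, if_pos rfl, ← mul_pow, h2]
    have h3 : ((2 * j).choose j : ℂ) * j ! * j ! = (2 * j)! := by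
      have := Nat.choose_mul_factorial_mul_factorial (show j ≤ 2 * j by omega)
      rw [h1] at this
      exact_mod_cast this
    have h4 : ((j ! : ℕ) : ℂ) ≠ 0 := by exact_mod_cast j.factorial_ne_zero
    rw [← h3]
    field_simp
  · intro m _ hm
    rw [if_neg (by omega), mul_zero]

lemma projectedMoment_two_mul_add_one (t : ℂ) (j : ℕ) : projectedMoment t (2 * j + 1) = 0 :=
  Finset.sum_eq_zero fun m _ => by rw [if_neg (by omega), mul_zero]

lemma sum_projectedMoment (t : ℂ) (L : ℕ) :
    ∑ k ∈ Finset.range (2 * L), Complex.I ^ k / k ! * projectedMoment t k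
      = ∑ j ∈ Finset.range L, (-(‖t‖ ^ 2 / 4 : ℝ) : ℂ) ^ j / j ! := by
  induction L with
  | zero => simp
  | succ L ih =>
    rw [show 2 * (L + 1) = 2 * L + 1 + 1 by ring, Finset.sum_range_succ, Finset.sum_range_succ, ih,
      Finset.sum_range_succ, projectedMoment_two_mul_add_one, projectedMoment_two_mul, pow_mul,
      Complex.I_sq, neg_pow (((‖t‖ ^ 2 / 4 : ℝ)) : ℂ)]
    have h4 : (((2 * L)! : ℕ) : ℂ) ≠ 0 := by exact_mod_cast (2 * L).factorial_ne_zero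
    field_simp
    ring

lemma inner_eq_conj_mul_add (w t : ℂ) :
    ((⟪w, t⟫ : ℝ) : ℂ) = conj t / 2 * w + t / 2 * conj w := by
  rw [Complex.inner]
  apply Complex.ext <;> simp <;> ring

section

variable {Ω : Type*} [MeasurableSpace Ω] {P : Measure Ω} [IsProbabilityMeasure P]

lemma tendsto_integral_inner_pow {W : ℕ → Ω → ℂ} (hW : ∀ N, AEMeasurable (W N) P)
    (hb : ∀ N, ∃ C, ∀ ω, ‖W N ω‖ ≤ C)
    (hm : ∀ a b : ℕ, Tendsto (fun N => ∫ ω, W N ω ^ a * conj (W N ω) ^ b ∂P) atTop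
      (𝓝 (if a = b then (a ! : ℂ) else 0))) (t : ℂ) (k : ℕ) :
    Tendsto (fun N => ∫ ω, ((⟪W N ω, t⟫ : ℝ) : ℂ) ^ k ∂P) atTop
      (𝓝 (projectedMoment t k)) := by
  have hint (N a b : ℕ) : Integrable (fun ω => W N ω ^ a * conj (W N ω) ^ b) P := by
    obtain ⟨C, hC⟩ := hb N
    refine Integrable.of_bound (C := C ^ a * C ^ b) ?_ (.of_forall fun ω => ?_)
    · exact (((hW N).pow_const a).mul
        ((Complex.continuous_conj.measurable.comp_aemeasurable (hW N)).pow_const b)).aestronglyMeasurable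
    · have h0 := (norm_nonneg _).trans (hC ω)
      rw [norm_mul, norm_pow, norm_pow, RCLike.norm_conj]
      gcongr <;> exact hC ω
  have hexp (N : ℕ) : ∫ ω, ((⟪W N ω, t⟫ : ℝ) : ℂ) ^ k ∂P
      = ∑ m ∈ Finset.range (k + 1), (conj t / 2) ^ m * (t / 2) ^ (k - m) * k.choose m
        * ∫ ω, W N ω ^ m * conj (W N ω) ^ (k - m) ∂P := by
    simp_rw [inner_eq_conj_mul_add, add_pow, ← integral_const_mul]
    rw [← integral_finsetSum _ fun m _ => (hint N m (k - m)).const_mul _]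
    refine integral_congr_ae (.of_forall fun ω => Finset.sum_congr rfl fun m _ => ?_)
    simp only [mul_pow]
    ring
  simp_rw [hexp]
  exact tendsto_finsetSum _ fun m _ => (hm m (k - m)).const_mul _

/-- Convergence of all mixed moments to those of the standard complex Gaussian law forces pointwise
convergence of the characteristic functions: the Taylor remainder of even order `2 L` is controlled
by the `2 L`-th moment, whose limit divided by `(2 L)!` is `(‖t‖ ^ 2 / 4) ^ L / L !`. -/
theorem tendsto_integral_exp_inner_of_tendsto_moments {W : ℕ → Ω → ℂ}
    (hW : ∀ N, AEMeasurable (W N) P) (hb : ∀ N, ∃ C, ∀ ω, ‖W N ω‖ ≤ C)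
    (hm : ∀ a b : ℕ, Tendsto (fun N => ∫ ω, W N ω ^ a * conj (W N ω) ^ b ∂P) atTop
      (𝓝 (if a = b then (a ! : ℂ) else 0))) (t : ℂ) :
    Tendsto (fun N => ∫ ω, Complex.exp ((⟪W N ω, t⟫ : ℝ) * Complex.I) ∂P) atTop
      (𝓝 (Complex.exp (-(‖t‖ ^ 2 / 4 : ℝ)))) := by
  set s : ℝ := ‖t‖ ^ 2 / 4 with hs
  set S : ℕ → ℂ := fun L => ∑ j ∈ Finset.range L, (-(s : ℂ)) ^ j / j ! with hS
  set T : ℕ → ℕ → ℂ := fun L N => ∑ k ∈ Finset.range (2 * L),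
    Complex.I ^ k / k ! * ∫ ω, ((⟪W N ω, t⟫ : ℝ) : ℂ) ^ k ∂P with hT
  have hmom := tendsto_integral_inner_pow hW hb hm t
  have hTlim (L : ℕ) : Tendsto (T L) atTop (𝓝 (S L)) := by
    have := tendsto_finsetSum (Finset.range (2 * L))
      fun k _ => (hmom k).const_mul (Complex.I ^ k / (k ! : ℂ))
    rw [sum_projectedMoment] at this
    exact this
  have hSlim : Tendsto S atTop (𝓝 (Complex.exp (-(s : ℂ)))) := by
    have := NormedSpace.expSeries_div_hasSum_exp (-(s : ℂ))
    rw [← Complex.exp_eq_exp_ℂ] at this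
    exact this.tendsto_sum_nat
  have hy (N : ℕ) : AEMeasurable (fun ω => ⟪W N ω, t⟫) P := (hW N).inner_const
  have hyb (N : ℕ) : ∃ C, ∀ ω, |⟪W N ω, t⟫| ≤ C := by
    obtain ⟨C, hC⟩ := hb N
    exact ⟨C * ‖t‖, fun ω => (abs_real_inner_le_norm _ _).trans (by gcongr; exact hC ω)⟩
  have hyint (N k : ℕ) : Integrable (fun ω => ⟪W N ω, t⟫ ^ k) P := by
    obtain ⟨C, hC⟩ := hyb N
    refine Integrable.of_bound (C := C ^ k) ((hy N).pow_const k).aestronglyMeasurable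
      (.of_forall fun ω => ?_)
    rw [norm_pow, Real.norm_eq_abs]
    gcongr
    exact hC ω
  have hrem (L N : ℕ) : ‖∫ ω, Complex.exp ((⟪W N ω, t⟫ : ℝ) * Complex.I) ∂P - T L N‖
      ≤ ‖∫ ω, ((⟪W N ω, t⟫ : ℝ) : ℂ) ^ (2 * L) ∂P‖ / (2 * L)! := by
    have hT' : T L N = ∫ ω, ∑ k ∈ Finset.range (2 * L),
        ((⟪W N ω, t⟫ : ℝ) * Complex.I) ^ k / (k ! : ℂ) ∂P := by
      rw [integral_finsetSum]
      · refine Finset.sum_congr rfl fun k _ => ?_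
        rw [← integral_const_mul]
        refine integral_congr_ae (.of_forall fun ω => ?_)
        simp only [mul_pow]
        ring
      · intro k _
        simp_rw [mul_pow, ← Complex.ofReal_pow]
        exact ((hyint N k).ofReal.mul_const _).div_const _
    have hsum : Integrable (fun ω => ∑ k ∈ Finset.range (2 * L),
        ((⟪W N ω, t⟫ : ℝ) * Complex.I) ^ k / k !) P := by
      refine integrable_finsetSum _ fun k _ => ?_
      simp_rw [mul_pow, ← Complex.ofReal_pow]
      exact ((hyint N k).ofReal.mul_const _).div_const _
    have hexp : Integrable (fun ω => Complex.exp ((⟪W N ω, t⟫ : ℝ) * Complex.I)) P := by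
      refine Integrable.of_bound (C := 1) ?_ (.of_forall fun ω => ?_)
      · exact ((Complex.measurable_ofReal.comp_aemeasurable (hy N)).mul_const _).cexp.aestronglyMeasurable
      · rw [Complex.norm_exp_ofReal_mul_I]
    rw [hT', ← integral_sub hexp hsum]
    refine (norm_integral_le_of_norm_le ((hyint N (2 * L)).div_const ((2 * L)! : ℝ))
      (.of_forall fun ω => ?_)).trans_eq ?_
    · refine (norm_exp_mul_I_sub_sum_le (2 * L) _).trans_eq ?_
      rw [pow_mul, sq_abs, ← pow_mul]
    · rw [integral_div]
      simp_rw [← Complex.ofReal_pow]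
      rw [integral_complex_ofReal, Complex.norm_real, Real.norm_eq_abs, abs_of_nonneg]
      exact integral_nonneg fun ω => by rw [pow_mul]; positivity
  rw [Metric.tendsto_atTop']
  intro ε hε
  have hfac := FloorSemiring.tendsto_pow_div_factorial_atTop s
  obtain ⟨L, hL1, hL2⟩ := ((Metric.tendsto_nhds.1 hSlim (ε / 4) (by positivity)).and
    (hfac.eventually_lt_const (show (0 : ℝ) < ε / 4 by positivity))).exists
  have hremlim : Tendsto (fun N => ‖∫ ω, ((⟪W N ω, t⟫ : ℝ) : ℂ) ^ (2 * L) ∂P‖ / (2 * L)!) atTop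
      (𝓝 (s ^ L / L !)) := by
    have h := ((hmom (2 * L)).norm.div_const ((2 * L)! : ℝ))
    have h4 : (((2 * L)! : ℕ) : ℝ) ≠ 0 := by exact_mod_cast (2 * L).factorial_ne_zero
    rw [projectedMoment_two_mul, norm_mul, norm_div, norm_pow, Complex.norm_natCast,
      Complex.norm_natCast, Complex.norm_real, Real.norm_eq_abs, abs_of_nonneg (by positivity),
      show (((2 * L)! : ℕ) : ℝ) / L ! * (‖t‖ ^ 2 / 4) ^ L / (2 * L)! = s ^ L / (L ! : ℝ) by
        rw [hs]; field_simp] at h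
    exact h
  obtain ⟨N₀, hN₀⟩ := eventually_atTop.1
    ((hremlim.eventually_lt_const hL2).and
      (Metric.tendsto_nhds.1 (hTlim L) (ε / 4) (by positivity)))
  refine ⟨N₀, fun N hN => ?_⟩
  obtain ⟨h1, h2⟩ := hN₀ N hN.le
  calc dist _ (Complex.exp (-(s : ℂ)))
      ≤ dist _ (T L N) + dist (T L N) (S L) + dist (S L) (Complex.exp (-(s : ℂ))) :=
        dist_triangle4 _ _ _ _
    _ < ε := by
        have h3 := (hrem L N).trans_lt h1
        rw [← dist_eq_norm] at h3
        linarith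

end

/-! ### Moments of the partial sums and the limit law -/

namespace IsUniformRandomMultiplicative

variable {Ω : Type*} [MeasurableSpace Ω] {P : Measure Ω} {X : ℕ → Ω → ℂ}

/-- By orthogonality, the mixed moments of the unnormalised sum count solutions. -/
lemma integral_sum_pow_mul_conj_sum_pow [IsProbabilityMeasure P]
    (hX : IsUniformRandomMultiplicative P X) (a b N : ℕ) :
    ∫ ω, (∑ n ∈ Finset.Icc 1 N, X n ω * X (n + 1) ω) ^ a
        * conj (∑ n ∈ Finset.Icc 1 N, X n ω * X (n + 1) ω) ^ b ∂P
      = (solutions a b N).card := by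
  classical
  have hprod {c : ℕ} {n : Fin c → ℕ} (hn : n ∈ Fintype.piFinset fun _ => Finset.Icc 1 N) (ω : Ω) :
      ∏ i, X (n i) ω * X (n i + 1) ω = X (∏ i, n i * (n i + 1)) ω := by
    have h1 (i : Fin c) : 1 ≤ n i := (Finset.mem_Icc.1 (Fintype.mem_piFinset.1 hn i)).1
    rw [hX.apply_prod _ _ fun i _ => Nat.mul_pos (h1 i) (n i).succ_pos]
    exact Finset.prod_congr rfl fun i _ => (hX.map_mul _ _ (h1 i) (n i).succ_pos ω).symm
  have hne {c : ℕ} {n : Fin c → ℕ} (hn : n ∈ Fintype.piFinset fun _ => Finset.Icc 1 N) :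
      ∏ i, n i * (n i + 1) ≠ 0 := prod_mul_succ_ne_zero (Fintype.mem_piFinset.1 hn)
  have hexp (ω : Ω) : (∑ n ∈ Finset.Icc 1 N, X n ω * X (n + 1) ω) ^ a
        * conj (∑ n ∈ Finset.Icc 1 N, X n ω * X (n + 1) ω) ^ b
      = ∑ s ∈ (Fintype.piFinset fun _ : Fin a => Finset.Icc 1 N) ×ˢ
          (Fintype.piFinset fun _ : Fin b => Finset.Icc 1 N),
        X (∏ i, s.1 i * (s.1 i + 1)) ω * conj (X (∏ i, s.2 i * (s.2 i + 1)) ω) := by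
    rw [← map_pow, Finset.sum_pow', Finset.sum_pow', map_sum, Finset.sum_mul_sum,
      Finset.sum_product]
    refine Finset.sum_congr rfl fun n hn => Finset.sum_congr rfl fun m hm => ?_
    rw [hprod hn, hprod hm]
  simp_rw [hexp]
  rw [integral_finsetSum]
  · rw [solutions, Finset.card_filter, Nat.cast_sum]
    refine Finset.sum_congr rfl fun s hs => ?_
    obtain ⟨h1, h2⟩ := Finset.mem_product.1 hs
    rw [hX.integral_mul_conj (hne h1) (hne h2)]
    split_ifs <;> simp
  · intro s hs
    obtain ⟨h1, h2⟩ := Finset.mem_product.1 hs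
    refine Integrable.of_bound (C := 1) ?_ (.of_forall fun ω => ?_)
    · exact ((hX.aemeasurable (hne h1)).mul
        (Complex.continuous_conj.measurable.comp_aemeasurable
          (hX.aemeasurable (hne h2)))).aestronglyMeasurable
    · rw [norm_mul, RCLike.norm_conj, hX.norm_eq_one _ (Nat.pos_of_ne_zero (hne h1)),
        hX.norm_eq_one _ (Nat.pos_of_ne_zero (hne h2)), one_mul]

lemma tendsto_integral_normalized_pow_mul_conj_pow [IsProbabilityMeasure P]
    (hX : IsUniformRandomMultiplicative P X)
    (hcount : ∀ q : ℕ, 1 ≤ q →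
      (fun N : ℕ => (numNontrivialSolutions q N : ℝ)) =o[atTop] fun N : ℕ => (N : ℝ) ^ q)
    (a b : ℕ) :
    Tendsto (fun N : ℕ => ∫ ω,
        (((Real.sqrt N : ℝ) : ℂ)⁻¹ * ∑ n ∈ Finset.Icc 1 N, X n ω * X (n + 1) ω) ^ a
        * conj (((Real.sqrt N : ℝ) : ℂ)⁻¹ * ∑ n ∈ Finset.Icc 1 N, X n ω * X (n + 1) ω) ^ b ∂P)
      atTop (𝓝 (if a = b then (a ! : ℂ) else 0)) := by
  have hmoment (N : ℕ) : ∫ ω,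
        (((Real.sqrt N : ℝ) : ℂ)⁻¹ * ∑ n ∈ Finset.Icc 1 N, X n ω * X (n + 1) ω) ^ a
        * conj (((Real.sqrt N : ℝ) : ℂ)⁻¹ * ∑ n ∈ Finset.Icc 1 N, X n ω * X (n + 1) ω) ^ b ∂P
      = (((Real.sqrt N)⁻¹ ^ (a + b) * (solutions a b N).card : ℝ) : ℂ) := by
    rw [Complex.ofReal_mul, Complex.ofReal_natCast, ← hX.integral_sum_pow_mul_conj_sum_pow,
      ← integral_const_mul]
    refine integral_congr_ae (.of_forall fun ω => ?_)
    simp only [_root_.map_mul, map_inv₀, Complex.conj_ofReal, Complex.ofReal_pow, Complex.ofReal_inv]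
    ring
  simp_rw [hmoment]
  split_ifs with hab
  · subst hab
    rw [← Complex.ofReal_natCast]
    refine (Complex.continuous_ofReal.tendsto _).comp
      ((tendsto_card_solutions_self_div hcount a).congr fun N => ?_)
    rw [← two_mul, pow_mul, inv_pow, Real.sq_sqrt N.cast_nonneg, inv_pow, div_eq_inv_mul]
  · rw [← Complex.ofReal_zero]
    refine (Complex.continuous_ofReal.tendsto _).comp ?_
    have h := (isLittleO_card_solutions_sq hcount hab).tendsto_div_nhds_zero.sqrt
    rw [Real.sqrt_zero] at h
    refine h.congr fun N => ?_
    have hN : (N : ℝ) ^ (a + b) = (Real.sqrt N ^ (a + b)) ^ 2 := by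
      rw [← pow_mul, mul_comm, pow_mul, Real.sq_sqrt N.cast_nonneg]
    rw [hN, Real.sqrt_div (by positivity), Real.sqrt_sq (by positivity),
      Real.sqrt_sq (by positivity), inv_pow, div_eq_inv_mul]

end IsUniformRandomMultiplicative

/-- The characteristic function of the standard complex Gaussian law. -/
lemma integral_exp_inner_stdComplexGaussian {Ω' : Type*} [MeasurableSpace Ω'] {P' : Measure Ω'}
    {Z₁ Z₂ : Ω' → ℝ} (hZ₁ : HasLaw Z₁ (gaussianReal 0 1) P')
    (hZ₂ : HasLaw Z₂ (gaussianReal 0 1) P') (hZ : Z₁ ⟂ᵢ[P'] Z₂) (t : ℂ) :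
    ∫ ω, Complex.exp
      ((⟪((Z₁ ω : ℂ) + Complex.I * (Z₂ ω : ℂ)) / ((Real.sqrt 2 : ℝ) : ℂ), t⟫ : ℝ) * Complex.I) ∂P'
      = Complex.exp (-(‖t‖ ^ 2 / 4 : ℝ)) := by
  have hchar {Y : Ω' → ℝ} (hY : HasLaw Y (gaussianReal 0 1) P') (s : ℝ) :
      ∫ ω, Complex.exp (s * Y ω * Complex.I) ∂P' = Complex.exp (-(s ^ 2 / 2 : ℝ)) := by
    have h := hY.integral_comp (f := fun y : ℝ => Complex.exp (s * y * Complex.I))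
      (Continuous.aestronglyMeasurable (by fun_prop))
    rw [← charFun_apply_real, charFun_gaussianReal] at h
    refine h.trans ?_
    congr 1
    push_cast
    ring
  have hinner (ω : Ω') :
      Complex.exp ((⟪((Z₁ ω : ℂ) + Complex.I * (Z₂ ω : ℂ)) / ((Real.sqrt 2 : ℝ) : ℂ), t⟫ : ℝ)
        * Complex.I)
      = Complex.exp ((t.re / Real.sqrt 2 : ℝ) * Z₁ ω * Complex.I)
        * Complex.exp ((t.im / Real.sqrt 2 : ℝ) * Z₂ ω * Complex.I) := by
    rw [← Complex.exp_add, ← add_mul]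
    congr 2
    rw [← Complex.ofReal_mul, ← Complex.ofReal_mul, ← Complex.ofReal_add, Complex.inner]
    congr 1
    simp [Complex.div_ofReal_re, Complex.div_ofReal_im]
    ring
  simp_rw [hinner]
  rw [hZ.integral_fun_comp_mul_comp
    (f := fun x : ℝ => Complex.exp ((t.re / Real.sqrt 2 : ℝ) * x * Complex.I))
    (g := fun x : ℝ => Complex.exp ((t.im / Real.sqrt 2 : ℝ) * x * Complex.I))
    hZ₁.aemeasurable hZ₂.aemeasurable
    (Continuous.aestronglyMeasurable (by fun_prop)) (Continuous.aestronglyMeasurable (by fun_prop)),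
    hchar hZ₁, hchar hZ₂, ← Complex.exp_add, ← Complex.ofReal_neg, ← Complex.ofReal_neg,
    ← Complex.ofReal_add, ← Complex.ofReal_neg]
  congr 2
  rw [← Complex.normSq_eq_norm_sq, Complex.normSq_apply, div_pow, div_pow,
    Real.sq_sqrt zero_le_two]
  ring

theorem mainTheorem11 {Ω Ω' : Type*} [MeasurableSpace Ω] [MeasurableSpace Ω']
    (P : Measure Ω) [IsProbabilityMeasure P] (P' : Measure Ω') [IsProbabilityMeasure P']
    (X : ℕ → Ω → ℂ) (hX : IsUniformRandomMultiplicative P X)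
    (hcount : ∀ q : ℕ, 1 ≤ q →
      (fun N : ℕ => (numNontrivialSolutions q N : ℝ)) =o[atTop] fun N : ℕ => (N : ℝ) ^ q)
    (Z₁ Z₂ : Ω' → ℝ) (hZ₁ : HasLaw Z₁ (gaussianReal 0 1) P')
    (hZ₂ : HasLaw Z₂ (gaussianReal 0 1) P') (hZ : Z₁ ⟂ᵢ[P'] Z₂) :
    TendstoInDistribution
      (fun (N : ℕ) (ω : Ω) => ((Real.sqrt N : ℝ) : ℂ)⁻¹ * ∑ n ∈ Finset.Icc 1 N, X n ω * X (n + 1) ω)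
      atTop
      (fun ω' : Ω' => ((Z₁ ω' : ℂ) + Complex.I * (Z₂ ω' : ℂ)) / ((Real.sqrt 2 : ℝ) : ℂ))
      (fun _ => P) P' := by
  have hW (N : ℕ) : AEMeasurable
      (fun ω => ((Real.sqrt N : ℝ) : ℂ)⁻¹ * ∑ n ∈ Finset.Icc 1 N, X n ω * X (n + 1) ω) P := by
    refine (Finset.aemeasurable_fun_sum _ fun n hn => ?_).const_mul _
    have h1 := (Finset.mem_Icc.1 hn).1
    exact (hX.aemeasurable (by omega)).mul (hX.aemeasurable n.succ_ne_zero)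
  have hb (N : ℕ) : ∃ C, ∀ ω,
      ‖((Real.sqrt N : ℝ) : ℂ)⁻¹ * ∑ n ∈ Finset.Icc 1 N, X n ω * X (n + 1) ω‖ ≤ C := by
    refine ⟨‖((Real.sqrt N : ℝ) : ℂ)⁻¹‖ * ∑ n ∈ Finset.Icc 1 N, 1, fun ω => ?_⟩
    rw [norm_mul]
    refine mul_le_mul_of_nonneg_left (norm_sum_le_of_le _ fun n hn => ?_) (norm_nonneg _)
    rw [norm_mul, hX.norm_eq_one n (Finset.mem_Icc.1 hn).1, hX.norm_eq_one _ n.succ_pos, one_mul]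
  have hZm : AEMeasurable
      (fun ω' => ((Z₁ ω' : ℂ) + Complex.I * (Z₂ ω' : ℂ)) / ((Real.sqrt 2 : ℝ) : ℂ)) P' :=
    ((Complex.measurable_ofReal.comp_aemeasurable hZ₁.aemeasurable).add
      ((Complex.measurable_ofReal.comp_aemeasurable hZ₂.aemeasurable).const_mul _)).div_const _
  refine ⟨hW, hZm, ProbabilityMeasure.tendsto_iff_tendsto_charFun.2 fun t => ?_⟩
  have key := tendsto_integral_exp_inner_of_tendsto_moments hW hb
    (hX.tendsto_integral_normalized_pow_mul_conj_pow hcount) t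
  rw [← integral_exp_inner_stdComplexGaussian hZ₁ hZ₂ hZ t] at key
  simp only [ProbabilityMeasure.coe_mk]
  rw [charFun_apply, integral_map hZm (Continuous.aestronglyMeasurable (by fun_prop))]
  refine key.congr fun N => ?_
  rw [charFun_apply, integral_map (hW N) (Continuous.aestronglyMeasurable (by fun_prop))]
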